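/- Let $p$ be a discrete probability distribution on a (finite or countable) domain $D$ with $p(x)>0$ for all $x\in D$, let $f:D\to\mathbb R$, and let $k$ be an integer with $0\le k<|D|$. For $\phi\in\mathbb R$ let $F_\phi(x)=\exp(-\exp(-x+\phi))$ be the distribution function of the $\mathrm{Gumbel}(\phi)$ distribution. Put $\phi_i=\log p(i)$, let $(g_i)_{i\in D}$ be independent $\mathrm{Gumbel}(0)$ random variables, and call $g_{\phi_i}=\phi_i+g_i$ the perturbed log-probabilities. Let $S^k$ be the (random) set of the $k$ elements with the largest perturbed log-probabilities, and let $\kappa$ be the $(k+1)$-th largest perturbed log-probability. For finite sets $C,S\subseteq D$ that are disjoint, with $S$ of size $m$, let \[ p^{D\setminus C}(S)=\sum_{(b_1,\dots,b_m)}\ \prod_{i=1}^m\frac{p(b_i)}{1-\sum_{c\in C}p(c)-\sum_{j<i}p(b_j)}, \] where the sum runs over all $m!$ orderings of $S$, and write $p(S)=p^{D\setminus\emptyset}(S)$. For $s\in S$ let $R(S,s)=p^{D\setminus\{s\}}(S\setminus\{s\})/p(S)$ be the leave-one-out ratio. Then for every set $S\subseteq D$ with $k$ elements the event $S^k=S$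 has positive probability, and, conditionally on this event, the importance-weighted estimator $\sum_{s\in S}\frac{p(s)}{1-F_{\phi_s}(\kappa)}f(s)$ is integrable and its conditional expectation is the unordered set estimator: \[ \mathbb E\Bigl[\,\sum_{s\in S}\frac{p(s)}{1-F_{\phi_s}(\kappa)}\,f(s)\ \Big|\ S^k=S\Bigr]=\sum_{s\in S}p(s)\,R(S,s)\,f(s). \] Moreover, for each $s\in S$, the random variable $1/(1-F_{\phi_s}(\kappa))$ is integrable conditionally on $S^k=S$, and \[ \mathbb E\Bigl[\frac1{1-F_{\phi_s}(\kappa)}\ \Big|\ S^k=S\Bigr]=R(S,s). \] -/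

import Mathlib

namespace GumbelTopK

open MeasureTheory ProbabilityTheory

noncomputable section

/-- The cumulative distribution function `F_φ(x) = exp(-exp(-x + φ))` of the Gumbel distribution
with location `φ`. -/
def gumbelCDF (φ x : ℝ) : ℝ := Real.exp (-Real.exp (-x + φ))

/-- The density `f_φ(x) = exp(-x + φ) F_φ(x)` of the Gumbel distribution with location `φ`. -/
def gumbelPDF (φ x : ℝ) : ℝ := Real.exp (-x + φ) * gumbelCDF φ x

/-- The Gumbel distribution with location `φ`, as a measure on `ℝ`. -/
def gumbelMeasure (φ : ℝ) : Measure ℝ :=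
  volume.withDensity fun x => ENNReal.ofReal (gumbelPDF φ x)

/-- `gumbelCDF φ` is indeed the distribution function of `gumbelMeasure φ`. -/
theorem gumbelMeasure_Iic (φ x : ℝ) :
    gumbelMeasure φ (Set.Iic x) = ENNReal.ofReal (gumbelCDF φ x) := by
  have hd : ∀ y ∈ Set.Iic x, HasDerivAt (gumbelCDF φ) (gumbelPDF φ y) y := by
    intro y _
    have h := ((((hasDerivAt_id y).neg).add_const φ).exp.neg).exp
    refine h.congr_deriv ?_
    simp only [gumbelPDF, gumbelCDF, id, Pi.neg_apply]
    ring
  have hnn : ∀ y, 0 ≤ gumbelPDF φ y := fun y => by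
    unfold gumbelPDF gumbelCDF; positivity
  have hlim : Filter.Tendsto (gumbelCDF φ) Filter.atBot (nhds 0) := by
    refine Real.tendsto_exp_atBot.comp (Filter.tendsto_neg_atTop_atBot.comp
      (Real.tendsto_exp_atTop.comp ?_))
    exact Filter.tendsto_atTop_add_const_right _ _ Filter.tendsto_neg_atBot_atTop
  have hcont : Continuous (gumbelPDF φ) := by
    unfold gumbelPDF gumbelCDF; fun_prop
  have hint : IntegrableOn (gumbelPDF φ) (Set.Iic x) := by
    refine integrableOn_Iic_of_intervalIntegral_norm_bounded (gumbelCDF φ x) x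
      (fun a : ℝ => hcont.integrableOn_Ioc) Filter.tendsto_id ?_
    filter_upwards [Filter.eventually_le_atBot x] with a ha
    simp only [Real.norm_of_nonneg (hnn _), id]
    rw [intervalIntegral.integral_eq_sub_of_hasDerivAt
      (fun y hy => hd y (by rw [Set.uIcc_of_le ha] at hy; exact hy.2))
      (hcont.intervalIntegrable _ _)]
    exact sub_le_self _ (Real.exp_pos _).le
  rw [gumbelMeasure, withDensity_apply _ measurableSet_Iic,
    ← ofReal_integral_eq_lintegral_ofReal hint (Filter.Eventually.of_forall hnn),
    integral_Iic_of_hasDerivAt_of_tendsto' hd hint hlim, sub_zero]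

variable {D : Type*}

/-- Probability `p^{D \ C}(B)` of the ordered sample without replacement `B = (b_1, …, b_k)` from
the distribution `p` restricted to `D \ C`. -/
def orderedProb (p : D → ℝ) (C : Finset D) {k : ℕ} (b : Fin k → D) : ℝ :=
  ∏ i : Fin k, p (b i) / (1 - ∑ c ∈ C, p c - ∑ j ∈ Finset.Iio i, p (b j))

open Classical in
/-- Probability `p^{D \ C}(S)` of the unordered sample without replacement `S` from the
distribution `p` restricted to `D \ C`: the sum of the probabilities of all orderings of `S`. -/
def unorderedProb (p : D → ℝ) (C S : Finset D) : ℝ :=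
  ∑ b : Fin S.card ≃ {x // x ∈ S}, orderedProb p C fun i => (b i : D)

open Classical in
/-- The leave-one-out ratio `R(S, s) = p^{D \ {s}}(S \ {s}) / p(S)`. -/
def leaveOneOutRatio (p : D → ℝ) (S : Finset D) (s : D) : ℝ :=
  unorderedProb p {s} (S.erase s) / unorderedProb p ∅ S

/-- The unordered set estimator `∑_{s ∈ S} p(s) R(S, s) f(s)`. -/
def unorderedSetEstimator (p f : D → ℝ) (S : Finset D) : ℝ :=
  ∑ s ∈ S, p s * leaveOneOutRatio p S s * f s

/-- The importance-weighted estimator `∑_{s ∈ S} p(s) / (1 - F_{φ_s}(κ)) f(s)` with threshold `κ`,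
where `φ_s = log p(s)`. -/
def importanceWeightedEstimator (p f : D → ℝ) (S : Finset D) (κ : ℝ) : ℝ :=
  ∑ s ∈ S, p s / (1 - gumbelCDF (Real.log (p s)) κ) * f s

/-- The perturbed log-probabilities `log p(i) + g_i`. -/
def perturbed (p : D → ℝ) (g : D → ℝ) (i : D) : ℝ := Real.log (p i) + g i

/-- The set of the `k` largest entries of `x`: the indices `i` for which fewer than `k` entries are
strictly larger than `x i`. -/
def topK (k : ℕ) (x : D → ℝ) : Set D := {i | {j | x i < x j}.encard < k}

/-- The value of the `m`-th largest entry of `x` (counted with multiplicity): the largest `t` such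
that at least `m` entries are `≥ t`. -/
def nthLargest (m : ℕ) (x : D → ℝ) : ℝ := sSup {t : ℝ | (m : ℕ∞) ≤ {i | t ≤ x i}.encard}

end

end GumbelTopK

open GumbelTopK MeasureTheory ProbabilityTheory

/-!
Let `X i = log p(i) + g i` be the perturbed log-probabilities, let `S` be a finite set with
nonempty complement, and write `q > 0` for the mass of `p` outside `S`.

* Whatever the ties, `S` is the set of the top `#S` entries iff every `X s` with `s ∈ S` exceeds
  every `X i` with `i ∉ S` (`topK_eq_iff`), and on this event the threshold `κ` is the supremum `M`
  of the `X i` with `i ∉ S` (`nthLargest_eq_iSup`).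
* `M` is a supremum of independent Gumbel variables, hence has the law `Gumbel(log q)`
  (`hasLaw_iSup_gumbel`), and it is independent of `(X s)_{s ∈ S}`. Given `M = t`, the event
  therefore has probability `∏_{s ∈ S} (1 - F_s(t))`, where `F_s` is the distribution function of
  `Gumbel(log p(s))` (`setLIntegral_iSup_compl`).
* Weighting by `1 / (1 - F_s(M))` removes the factor of `s` from this product. It remains to
  identify `∫ ∏_{s ∈ S} (1 - F_s) dGumbel(log q)` with the probability `p^{D \ C}(S)` of sampling
  `S` without replacement, where now `q = 1 - p(C) - p(S)` (`integral_prod_gumbelMeasure`). This is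
  used with `C = ∅` for the probability of the event and with `S \ {s}`, `C = {s}` for the weighted
  expectation; `q` is the same in both cases, and the quotient is the leave-one-out ratio.

Both sides of the identification equal `∑_{T ⊆ S} (-1)^{|T|} q / (q + p(T))`. For the integral,
expand the product and note that multiplying the `Gumbel(log q)` density by
`∏_{s ∈ T} F_s(t) = exp(-p(T) e^{-t})` gives `q / (q + p(T))` times a Gumbel density. For the
sampling probability, condition on the first element drawn and check that the inclusion-exclusion
sum satisfies the same recursion (`unorderedProb_eq_sum_powerset`).
-/

namespace GumbelTopK

open MeasureTheory ProbabilityTheory Finset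

variable {D : Type*}

/-! ### Sampling without replacement -/

lemma orderedProb_succ [DecidableEq D] (p : D → ℝ) (C : Finset D) {n : ℕ} (b : Fin (n + 1) → D)
    (h0 : b 0 ∉ C) :
    orderedProb p C b =
      p (b 0) / (1 - ∑ c ∈ C, p c) * orderedProb p (insert (b 0) C) fun i => b i.succ := by
  have hIio (i : Fin n) : ∑ j ∈ Iio i.succ, p (b j) = p (b 0) + ∑ j ∈ Iio i, p (b j.succ) := by
    have : Iio i.succ = insert 0 ((Iio i).map (Fin.succEmb n)) := by
      ext j
      cases j using Fin.cases <;> simp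
    rw [this, sum_insert (by simp), sum_map]
    simp
  have hbot : Iio (0 : Fin (n + 1)) = ∅ := by
    ext j
    simp
  simp only [orderedProb]
  rw [Fin.prod_univ_succ]
  simp only [hIio, sum_insert h0, hbot, sum_empty, sub_zero]
  congr 1
  exact prod_congr rfl fun i _ => by rw [add_comm (p (b 0)), ← sub_sub, ← sub_sub]; ring

open Classical in
lemma unorderedProb_eq_sum_equiv (p : D → ℝ) (C S : Finset D) {n : ℕ} (hn : S.card = n) :
    unorderedProb p C S = ∑ b : Fin n ≃ {x // x ∈ S}, orderedProb p C fun i => (b i : D) := by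
  subst hn
  rfl

open Classical in
/-- Orderings of `S` with first element `s` correspond to orderings of `S \ {s}`. -/
lemma sum_equiv_fiber {S : Finset D} {n : ℕ} (s : {x // x ∈ S}) (F : (Fin n → D) → ℝ) :
    ∑ b : Fin (n + 1) ≃ {x // x ∈ S} with b 0 = s, F (fun i => (b i.succ : D)) =
      ∑ b : Fin n ≃ {x // x ∈ S.erase s}, F fun i => (b i : D) := by
  let e₁ : {y : {x // x ∈ S} // y ≠ s} ≃ {x // x ∈ S.erase s} :=
    { toFun := fun y => ⟨y.1.1, mem_erase.2 ⟨fun h => y.2 (Subtype.ext h), y.1.2⟩⟩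
      invFun := fun x => ⟨⟨x.1, (mem_erase.1 x.2).2⟩,
        fun h => (mem_erase.1 x.2).1 (congrArg Subtype.val h)⟩
      left_inv := fun _ => rfl
      right_inv := fun _ => rfl }
  let e₂ : {b : Fin (n + 1) ≃ {x // x ∈ S} // b 0 = s} ≃
      {b : Option (Fin n) ≃ {x // x ∈ S} // b none = s} :=
    ((finSuccEquiv n).equivCongr (Equiv.refl _)).subtypeEquiv fun b => by simp
  let e := (e₂.trans (Equiv.optionSubtype s)).trans ((Equiv.refl (Fin n)).equivCongr e₁)
  rw [← sum_subtype_eq_sum_filter, Finset.subtype_univ, ← Equiv.sum_comp e]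
  refine sum_congr rfl fun b _ => congrArg F (funext fun i => ?_)
  simp [e, e₁, e₂]

/-- The probability of an unordered sample, split according to its first element. -/
lemma unorderedProb_eq_sum_first [DecidableEq D] (p : D → ℝ) (C S : Finset D) (hS : S.Nonempty)
    (hCS : Disjoint C S) :
    unorderedProb p C S =
      ∑ s ∈ S, p s / (1 - ∑ c ∈ C, p c) * unorderedProb p (insert s C) (S.erase s) := by
  classical
  obtain ⟨n, hn⟩ : ∃ n, S.card = n + 1 := ⟨S.card - 1, by have := hS.card_pos; omega⟩
  rw [unorderedProb_eq_sum_equiv p C S hn, ← sum_coe_sort S]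
  refine (sum_fiberwise _ (fun b : Fin (n + 1) ≃ {x // x ∈ S} => b 0) _).symm.trans ?_
  refine sum_congr rfl fun s _ => ?_
  rw [unorderedProb_eq_sum_equiv p _ (S.erase s) (n := n) (by rw [card_erase_of_mem s.2, hn]; rfl)]
  trans p s / (1 - ∑ c ∈ C, p c) * ∑ b : Fin (n + 1) ≃ {x // x ∈ S} with b 0 = s,
    orderedProb p (insert (s : D) C) fun i => (b i.succ : D)
  · rw [mul_sum]
    refine sum_congr (by congr; exact Subsingleton.elim _ _) fun b hb => ?_
    obtain rfl : b 0 = s := by simpa using hb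
    rw [orderedProb_succ _ _ _ (Finset.disjoint_right.1 hCS (b 0).2)]
  · congr 1
    convert sum_equiv_fiber s fun b => orderedProb p (insert (s : D) C) b

lemma unorderedProb_empty (p : D → ℝ) (C : Finset D) : unorderedProb p C ∅ = 1 := by
  classical
  rw [unorderedProb_eq_sum_equiv p C ∅ (n := 0) rfl]
  have : Unique (Fin 0 ≃ {x : D // x ∈ (∅ : Finset D)}) :=
    ⟨⟨Equiv.equivOfIsEmpty _ _⟩, fun _ => Equiv.ext fun i => i.elim0⟩
  simp [orderedProb]

lemma unorderedProb_pos (p : D → ℝ) (hp : ∀ i, 0 < p i) (S : Finset D) (C : Finset D)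
    (hCS : Disjoint C S) (h : ∑ c ∈ C, p c + ∑ s ∈ S, p s < 1) : 0 < unorderedProb p C S := by
  classical
  induction hn : S.card generalizing C S with
  | zero => rw [card_eq_zero.1 hn, unorderedProb_empty]; exact one_pos
  | succ n ih =>
    have hne : S.Nonempty := card_pos.1 (by omega)
    rw [unorderedProb_eq_sum_first p C S hne hCS]
    refine sum_pos (fun s hs => mul_pos (div_pos (hp s) ?_) (ih _ _ ?_ ?_ ?_)) hne
    · linarith [sum_nonneg fun s (_ : s ∈ S) => (hp s).le]
    · exact disjoint_insert_left.2 ⟨notMem_erase _ _, hCS.mono_right (erase_subset _ _)⟩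
    · rw [sum_insert (disjoint_right.1 hCS hs)]
      linarith [add_sum_erase S p hs]
    · rw [card_erase_of_mem hs, hn]; rfl

/-- The recursion of `unorderedProb_eq_sum_first`, for the inclusion-exclusion sum. -/
lemma mul_sum_powerset_inv [DecidableEq D] (p : D → ℝ) (hp : ∀ i, 0 < p i) (S : Finset D)
    (hS : S.Nonempty) {q : ℝ} (hq : 0 < q) :
    (q + ∑ s ∈ S, p s) * ∑ T ∈ S.powerset, (-1) ^ T.card / (q + ∑ t ∈ T, p t) =
      ∑ s ∈ S, p s * ∑ T ∈ (S.erase s).powerset, (-1) ^ T.card / (q + ∑ t ∈ T, p t) := by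
  have hswap : ∑ s ∈ S, p s * ∑ T ∈ (S.erase s).powerset, (-1) ^ T.card / (q + ∑ t ∈ T, p t) =
      ∑ T ∈ S.powerset, ∑ s ∈ S \ T, p s * ((-1) ^ T.card / (q + ∑ t ∈ T, p t)) := by
    simp_rw [mul_sum]
    refine sum_comm' fun s T => ?_
    simp only [mem_powerset, mem_sdiff, subset_erase]
    tauto
  have hterm : ∀ T ∈ S.powerset, ∑ s ∈ S \ T, p s * ((-1) ^ T.card / (q + ∑ t ∈ T, p t)) =
      (q + ∑ s ∈ S, p s) * ((-1) ^ T.card / (q + ∑ t ∈ T, p t)) - (-1) ^ T.card := by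
    intro T hT
    have hpos : 0 < q + ∑ t ∈ T, p t := add_pos_of_pos_of_nonneg hq
      (sum_nonneg fun t _ => (hp t).le)
    rw [← sum_mul, ← sum_sdiff (mem_powerset.1 hT)]
    field_simp
    ring
  have hzero : ∑ T ∈ S.powerset, (-1 : ℝ) ^ T.card = 0 := by
    have := sum_powerset_neg_one_pow_card_of_nonempty hS
    exact_mod_cast this
  rw [hswap, sum_congr rfl hterm, sum_sub_distrib, hzero, sub_zero, mul_sum]

/-- Inclusion-exclusion formula for the probability of an unordered sample. -/
lemma unorderedProb_eq_sum_powerset (p : D → ℝ) (hp : ∀ i, 0 < p i) (S : Finset D)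
    (C : Finset D) (hCS : Disjoint C S) {q : ℝ} (hq : 0 < q)
    (h : q + ∑ c ∈ C, p c + ∑ s ∈ S, p s = 1) :
    unorderedProb p C S = ∑ T ∈ S.powerset, (-1) ^ T.card * (q / (q + ∑ t ∈ T, p t)) := by
  classical
  have hG (S : Finset D) : ∑ T ∈ S.powerset, (-1) ^ T.card * (q / (q + ∑ t ∈ T, p t)) =
      q * ∑ T ∈ S.powerset, (-1) ^ T.card / (q + ∑ t ∈ T, p t) := by
    rw [mul_sum]
    exact sum_congr rfl fun T _ => by ring
  induction hn : S.card generalizing C S with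
  | zero => simp [card_eq_zero.1 hn, unorderedProb_empty, hq.ne']
  | succ n ih =>
    have hne : S.Nonempty := card_pos.1 (by omega)
    have hpos : 0 < q + ∑ s ∈ S, p s := add_pos_of_pos_of_nonneg hq
      (sum_nonneg fun t _ => (hp t).le)
    have hC : 1 - ∑ c ∈ C, p c = q + ∑ s ∈ S, p s := by linarith
    rw [unorderedProb_eq_sum_first p C S hne hCS, hG, ← mul_right_inj' hpos.ne', ← mul_assoc,
      mul_comm _ q, mul_assoc, mul_sum_powerset_inv p hp S hne hq, hC, mul_sum, mul_sum]
    refine sum_congr rfl fun s hs => ?_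
    rw [ih (S.erase s) (insert s C), hG]
    · field_simp
    · exact disjoint_insert_left.2 ⟨notMem_erase _ _, hCS.mono_right (erase_subset _ _)⟩
    · rw [sum_insert (disjoint_right.1 hCS hs)]
      linarith [add_sum_erase S p hs]
    · rw [card_erase_of_mem hs, hn]; rfl

/-! ### The Gumbel distribution -/

lemma gumbelCDF_pos (φ x : ℝ) : 0 < gumbelCDF φ x := Real.exp_pos _

lemma gumbelCDF_lt_one (φ x : ℝ) : gumbelCDF φ x < 1 := by
  rw [gumbelCDF, Real.exp_lt_one_iff]
  exact neg_neg_of_pos (Real.exp_pos _)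

lemma measurable_gumbelCDF (φ : ℝ) : Measurable (gumbelCDF φ) := by
  unfold gumbelCDF
  fun_prop

lemma measurable_gumbelPDF (φ : ℝ) : Measurable (gumbelPDF φ) := by
  unfold gumbelPDF gumbelCDF
  fun_prop

lemma gumbelCDF_log {a : ℝ} (ha : 0 < a) (x : ℝ) :
    gumbelCDF (Real.log a) x = Real.exp (-(a * Real.exp (-x))) := by
  rw [gumbelCDF, Real.exp_add, Real.exp_log ha, mul_comm]

lemma gumbelCDF_zero_sub (φ x : ℝ) : gumbelCDF 0 (x - φ) = gumbelCDF φ x := by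
  simp only [gumbelCDF]
  ring_nf

lemma tendsto_gumbelCDF_atTop (φ : ℝ) :
    Filter.Tendsto (gumbelCDF φ) Filter.atTop (nhds 1) := by
  have h : Filter.Tendsto (fun x : ℝ => -x + φ) Filter.atTop Filter.atBot :=
    Filter.tendsto_atBot_add_const_right _ _ Filter.tendsto_neg_atTop_atBot
  have := (Real.tendsto_exp_atBot.comp h).neg.rexp
  unfold gumbelCDF
  simpa using this

instance isProbabilityMeasure_gumbelMeasure (φ : ℝ) : IsProbabilityMeasure (gumbelMeasure φ) := by
  refine ⟨?_⟩
  have h1 := tendsto_measure_Iic_atTop (gumbelMeasure φ)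
  simp_rw [gumbelMeasure_Iic] at h1
  have h2 := ENNReal.tendsto_ofReal (tendsto_gumbelCDF_atTop φ)
  rw [ENNReal.ofReal_one] at h2
  exact tendsto_nhds_unique h1 h2

lemma gumbelMeasure_singleton (φ x : ℝ) : gumbelMeasure φ {x} = 0 :=
  withDensity_absolutelyContinuous _ _ Real.volume_singleton

lemma gumbelMeasure_Ioi (φ x : ℝ) :
    gumbelMeasure φ (Set.Ioi x) = ENNReal.ofReal (1 - gumbelCDF φ x) := by
  rw [← Set.compl_Iic, prob_compl_eq_one_sub measurableSet_Iic, gumbelMeasure_Iic,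
    ENNReal.ofReal_sub _ (gumbelCDF_pos φ x).le, ENNReal.ofReal_one]

/-- Translating the `Gumbel(0)` distribution by `φ` yields `Gumbel(φ)`. -/
lemma hasLaw_const_add_gumbel {Ω : Type*} [MeasurableSpace Ω] {P : Measure Ω} {X : Ω → ℝ}
    (hX : HasLaw X (gumbelMeasure 0) P) (φ : ℝ) :
    HasLaw (fun ω => φ + X ω) (gumbelMeasure φ) P where
  aemeasurable := hX.aemeasurable.const_add φ
  map_eq := by
    have hae : AEMeasurable (fun ω => φ + X ω) P := hX.aemeasurable.const_add φ
    have : IsProbabilityMeasure P := by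
      refine ⟨?_⟩
      have h := measure_univ (μ := gumbelMeasure 0)
      rwa [← hX.map_eq, Measure.map_apply_of_aemeasurable hX.aemeasurable .univ,
        Set.preimage_univ] at h
    have : IsProbabilityMeasure (P.map fun ω => φ + X ω) := Measure.isProbabilityMeasure_map hae
    refine Measure.ext_of_Iic _ _ fun t => ?_
    rw [Measure.map_apply_of_aemeasurable hae measurableSet_Iic, gumbelMeasure_Iic,
      ← gumbelCDF_zero_sub, ← gumbelMeasure_Iic, ← hX.map_eq,
      Measure.map_apply_of_aemeasurable hX.aemeasurable measurableSet_Iic]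
    congr 1
    ext ω
    simp [le_sub_iff_add_le']

/-- Tilting `Gumbel(log q)` by `F_{log a}` gives a multiple of `Gumbel(log (q + a))`; hence the
integral of `F_{log a}`, which is written out here so as to allow `a = 0`. -/
lemma integral_exp_gumbelMeasure {q a : ℝ} (hq : 0 < q) (ha : 0 ≤ a) :
    ∫ t, Real.exp (-(a * Real.exp (-t))) ∂gumbelMeasure (Real.log q) = q / (q + a) := by
  have hqa : 0 < q + a := by positivity
  have hmeas : Measurable fun t : ℝ => Real.exp (-(a * Real.exp (-t))) := by fun_prop
  have hnn (φ t : ℝ) : 0 ≤ gumbelPDF φ t := mul_nonneg (Real.exp_pos _).le (gumbelCDF_pos _ _).le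
  have hdens (t : ℝ) : gumbelPDF (Real.log q) t * Real.exp (-(a * Real.exp (-t))) =
      q / (q + a) * gumbelPDF (Real.log (q + a)) t := by
    simp only [gumbelPDF, gumbelCDF_log hq, gumbelCDF_log hqa, Real.exp_add, Real.exp_log hq,
      Real.exp_log hqa, add_mul, neg_add]
    field_simp
  rw [integral_eq_lintegral_of_nonneg_ae (.of_forall fun _ => (Real.exp_pos _).le)
    hmeas.aestronglyMeasurable, gumbelMeasure,
    lintegral_withDensity_eq_lintegral_mul _ (measurable_gumbelPDF _).ennreal_ofReal
      hmeas.ennreal_ofReal]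
  simp only [Pi.mul_apply, ← ENNReal.ofReal_mul (hnn _ _), hdens]
  simp only [ENNReal.ofReal_mul (div_pos hq hqa).le]
  rw [lintegral_const_mul _ (measurable_gumbelPDF _).ennreal_ofReal]
  have h1 := measure_univ (μ := gumbelMeasure (Real.log (q + a)))
  rw [gumbelMeasure, withDensity_apply _ .univ, Measure.restrict_univ] at h1
  rw [h1, mul_one, ENNReal.toReal_ofReal (div_pos hq hqa).le]

/-- The probability that every member of `S` beats an independent `Gumbel(log q)` threshold, where
`q` is the mass outside `C ∪ S`, is the sampling probability `p^{D \ C}(S)`. -/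
lemma integral_prod_gumbelMeasure (p : D → ℝ) (hp : ∀ i, 0 < p i) (S C : Finset D)
    (hCS : Disjoint C S) {q : ℝ} (hq : 0 < q) (h : q + ∑ c ∈ C, p c + ∑ s ∈ S, p s = 1) :
    ∫ t, ∏ s ∈ S, (1 - gumbelCDF (Real.log (p s)) t) ∂gumbelMeasure (Real.log q) =
      unorderedProb p C S := by
  classical
  have hexp (t : ℝ) : ∏ s ∈ S, (1 - gumbelCDF (Real.log (p s)) t) =
      ∑ T ∈ S.powerset, (-1) ^ T.card * Real.exp (-((∑ s ∈ T, p s) * Real.exp (-t))) := by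
    rw [prod_sub]
    refine sum_congr rfl fun T _ => ?_
    simp_rw [gumbelCDF_log (hp _), ← Real.exp_sum, sum_mul, sum_neg_distrib]
    simp
  have hnn (T : Finset D) : 0 ≤ ∑ s ∈ T, p s := sum_nonneg fun s _ => (hp s).le
  have hint (T : Finset D) : Integrable (fun t : ℝ => Real.exp (-((∑ s ∈ T, p s) * Real.exp (-t))))
      (gumbelMeasure (Real.log q)) := by
    refine .of_bound (C := 1) (by fun_prop) (.of_forall fun t => ?_)
    rw [Real.norm_of_nonneg (Real.exp_pos _).le, Real.exp_le_one_iff, neg_nonpos]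
    exact mul_nonneg (hnn T) (Real.exp_pos _).le
  simp_rw [hexp]
  rw [integral_finsetSum _ fun T _ => (hint T).const_mul _,
    unorderedProb_eq_sum_powerset p hp S C hCS hq h]
  exact sum_congr rfl fun T _ => by
    rw [integral_const_mul, integral_exp_gumbelMeasure hq (hnn T)]

lemma lintegral_prod_gumbelMeasure (p : D → ℝ) (hp : ∀ i, 0 < p i) (S C : Finset D)
    (hCS : Disjoint C S) {q : ℝ} (hq : 0 < q) (h : q + ∑ c ∈ C, p c + ∑ s ∈ S, p s = 1) :
    ∫⁻ t, ENNReal.ofReal (∏ s ∈ S, (1 - gumbelCDF (Real.log (p s)) t))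
      ∂gumbelMeasure (Real.log q) = ENNReal.ofReal (unorderedProb p C S) := by
  have hnn (t : ℝ) (s : D) : 0 ≤ 1 - gumbelCDF (Real.log (p s)) t :=
    sub_nonneg.2 (gumbelCDF_lt_one _ _).le
  have hmeas : Measurable fun t => ∏ s ∈ S, (1 - gumbelCDF (Real.log (p s)) t) :=
    Finset.measurable_fun_prod _ fun s _ => (measurable_gumbelCDF _).const_sub 1
  rw [← integral_prod_gumbelMeasure p hp S C hCS hq h, ofReal_integral_eq_lintegral_ofReal]
  · refine .of_bound (C := 1) hmeas.aestronglyMeasurable (.of_forall fun t => ?_)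
    rw [Real.norm_of_nonneg (prod_nonneg fun s _ => hnn t s)]
    exact prod_le_one (fun s _ => hnn t s) fun s _ => by linarith [gumbelCDF_pos (Real.log (p s)) t]
  · exact .of_forall fun t => prod_nonneg fun s _ => hnn t s

/-! ### Deterministic description of the top `k` entries -/

/-- `S` is the set of the `#S` largest entries iff it dominates its complement; ties and
non-attained suprema are allowed. -/
lemma topK_eq_iff (x : D → ℝ) (S : Finset D) :
    topK S.card x = S ↔ ∀ s ∈ S, ∀ i ∉ S, x i < x s := by
  constructor
  · intro h s hs i hi
    by_contra! hle
    have h1 : s ∈ topK S.card x := by rw [h]; exact hs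
    refine hi (Finset.mem_coe.1 (h ▸ ?_ : i ∈ (S : Set D)))
    exact (Set.encard_le_encard fun j (hj : x i < x j) => hle.trans_lt hj).trans_lt h1
  · intro h
    ext i
    rw [Finset.mem_coe]
    constructor
    · intro hi
      by_contra hiS
      have hsub : (S : Set D) ⊆ {j | x i < x j} := fun s hs => h s hs i hiS
      have := Set.encard_le_encard hsub
      rw [Set.encard_coe_eq_coe_finsetCard] at this
      exact absurd hi (not_lt.2 this)
    · intro hi
      classical
      have hsub : {j | x i < x j} ⊆ (S.erase i : Finset D) := fun j hj =>
        Finset.mem_coe.2 (mem_erase.2 ⟨fun hji => (hji ▸ hj : x i < x i).ne rfl,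
          by_contra fun hjS => lt_asymm hj (h i hi j hjS)⟩)
      have hcard := Set.encard_le_encard hsub
      rw [Set.encard_coe_eq_coe_finsetCard] at hcard
      refine hcard.trans_lt ?_
      exact_mod_cast card_erase_lt_of_mem hi

/-- When `S` consists of the largest entries, the next largest value is the supremum over the
complement of `S`, also when both are the junk value of an unbounded family. -/
lemma nthLargest_eq_iSup (x : D → ℝ) (S : Finset D) (hne : ∃ i, i ∉ S)
    (h : ∀ s ∈ S, ∀ i ∉ S, x i < x s) :
    nthLargest (S.card + 1) x = ⨆ i : {i // i ∉ S}, x i := by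
  have hset : {t : ℝ | ((S.card + 1 : ℕ) : ℕ∞) ≤ {i | t ≤ x i}.encard} =
      {t | ∃ i ∉ S, t ≤ x i} := by
    ext t
    constructor
    · intro ht
      by_contra hcon
      have hsub : {i | t ≤ x i} ⊆ (S : Set D) := fun i hi =>
        by_contra fun hiS => hcon ⟨i, fun h => hiS h, hi⟩
      have hle := (show _ ≤ _ from ht).trans (Set.encard_le_encard hsub)
      rw [Set.encard_coe_eq_coe_finsetCard] at hle
      have : S.card + 1 ≤ S.card := by exact_mod_cast hle
      omega
    · rintro ⟨i, hi, hti⟩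
      have hsub : ((Finset.cons i S hi : Finset D) : Set D) ⊆ {j | t ≤ x j} := by
        intro j hj
        rcases Finset.mem_cons.1 hj with rfl | hj
        · exact hti
        · exact hti.trans (h j hj i hi).le
      have := Set.encard_le_encard hsub
      rwa [Set.encard_coe_eq_coe_finsetCard, Finset.card_cons] at this
  have hlower : {t | ∃ i ∉ S, t ≤ x i} =
      (lowerClosure (Set.range fun i : {i // i ∉ S} => x i) : Set ℝ) := by
    ext t
    simp
  rw [nthLargest, hset, hlower, iSup]
  by_cases hb : BddAbove (Set.range fun i : {i // i ∉ S} => x i)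
  · have : Nonempty {i // i ∉ S} := hne.elim fun i hi => ⟨⟨i, hi⟩⟩
    refine IsLUB.csSup_eq ?_ (Set.range_nonempty _ |>.mono subset_lowerClosure)
    rw [IsLUB, upperBounds_lowerClosure]
    exact isLUB_csSup (Set.range_nonempty _) hb
  · rw [Real.sSup_of_not_bddAbove hb, Real.sSup_of_not_bddAbove]
    rwa [bddAbove_lowerClosure]

/-! ### The maximum of independent Gumbel variables -/

section Sup

variable {ι Ω : Type*} [Countable ι] [MeasurableSpace Ω] {P : Measure Ω} [IsProbabilityMeasure P]
  {p : ι → ℝ} {q : ℝ} {X : ι → Ω → ℝ}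

lemma measure_forall_le_gumbel (hp : ∀ i, 0 < p i) (hq : 0 < q) (hpq : HasSum p q)
    (hXm : ∀ i, Measurable (X i)) (hX : ∀ i, HasLaw (X i) (gumbelMeasure (Real.log (p i))) P)
    (hind : iIndepFun X P) (t : ℝ) :
    P {ω | ∀ i, X i ω ≤ t} = ENNReal.ofReal (gumbelCDF (Real.log q) t) := by
  have hfin (A : Finset ι) : P (⋂ i ∈ A, X i ⁻¹' Set.Iic t) =
      ENNReal.ofReal (Real.exp (-((∑ i ∈ A, p i) * Real.exp (-t)))) := by
    rw [hind.measure_inter_preimage_eq_mul A fun _ _ => measurableSet_Iic]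
    simp_rw [← Measure.map_apply (hXm _) measurableSet_Iic, (hX _).map_eq, gumbelMeasure_Iic,
      gumbelCDF_log (hp _)]
    rw [← ENNReal.ofReal_prod_of_nonneg fun _ _ => (Real.exp_pos _).le, ← Real.exp_sum, sum_mul,
      sum_neg_distrib]
  have h1 : Filter.Tendsto (fun A : Finset ι => P (⋂ i ∈ A, X i ⁻¹' Set.Iic t)) Filter.atTop
      (nhds (P (⋂ A : Finset ι, ⋂ i ∈ A, X i ⁻¹' Set.Iic t))) :=
    tendsto_measure_iInter_atTop
      (fun A => (Finset.measurableSet_biInter A fun i _ =>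
        hXm i measurableSet_Iic).nullMeasurableSet)
      (fun A B hAB => Set.biInter_subset_biInter_left hAB) ⟨∅, measure_ne_top _ _⟩
  have h2 : Filter.Tendsto (fun A : Finset ι => P (⋂ i ∈ A, X i ⁻¹' Set.Iic t)) Filter.atTop
      (nhds (ENNReal.ofReal (gumbelCDF (Real.log q) t))) := by
    simp_rw [hfin, gumbelCDF_log hq]
    refine ENNReal.tendsto_ofReal (Filter.Tendsto.rexp (Filter.Tendsto.neg ?_))
    exact Filter.Tendsto.mul_const _ hpq
  rw [← tendsto_nhds_unique h1 h2]
  congr 1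
  ext ω
  simp only [Set.mem_ofPred_eq, Set.mem_iInter, Set.mem_preimage, Set.mem_Iic]
  exact ⟨fun h _ i _ => h i, fun h i => h {i} i (mem_singleton_self i)⟩

lemma ae_bddAbove_gumbel (hp : ∀ i, 0 < p i) (hq : 0 < q) (hpq : HasSum p q)
    (hXm : ∀ i, Measurable (X i)) (hX : ∀ i, HasLaw (X i) (gumbelMeasure (Real.log (p i))) P)
    (hind : iIndepFun X P) :
    ∀ᵐ ω ∂P, BddAbove (Set.range fun i => X i ω) := by
  have hmeas : MeasurableSet {ω | BddAbove (Set.range fun i => X i ω)} :=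
    measurableSet_bddAbove_range hXm
  refine (mem_ae_iff_prob_eq_one hmeas).2 (le_antisymm prob_le_one ?_)
  have hlim := ENNReal.tendsto_ofReal (tendsto_gumbelCDF_atTop (Real.log q))
  rw [ENNReal.ofReal_one] at hlim
  refine le_of_tendsto' hlim fun t => ?_
  rw [← measure_forall_le_gumbel hp hq hpq hXm hX hind t]
  exact measure_mono fun ω hω => ⟨t, Set.forall_mem_range.2 hω⟩

/-- The supremum of independent Gumbel variables is Gumbel, with the total mass as its weight. -/
lemma hasLaw_iSup_gumbel (hp : ∀ i, 0 < p i) (hq : 0 < q) (hpq : HasSum p q)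
    (hXm : ∀ i, Measurable (X i)) (hX : ∀ i, HasLaw (X i) (gumbelMeasure (Real.log (p i))) P)
    (hind : iIndepFun X P) :
    HasLaw (fun ω => ⨆ i, X i ω) (gumbelMeasure (Real.log q)) P where
  aemeasurable := (Measurable.iSup hXm).aemeasurable
  map_eq := by
    have hM : Measurable fun ω => ⨆ i, X i ω := .iSup hXm
    have : Nonempty ι := by
      by_contra hempty
      rw [not_nonempty_iff] at hempty
      exact hq.ne' (hpq.unique hasSum_empty)
    have : IsProbabilityMeasure (P.map fun ω => ⨆ i, X i ω) :=
      Measure.isProbabilityMeasure_map hM.aemeasurable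
    refine Measure.ext_of_Iic _ _ fun t => ?_
    rw [Measure.map_apply hM measurableSet_Iic, gumbelMeasure_Iic,
      ← measure_forall_le_gumbel hp hq hpq hXm hX hind t]
    refine measure_congr ?_
    filter_upwards [ae_bddAbove_gumbel hp hq hpq hXm hX hind] with ω hω
    exact propext (ciSup_le_iff hω)

end Sup

/-! ### The event that `S` is on top, and its threshold -/

section Threshold

variable {Ω : Type*} [Countable D] [MeasurableSpace Ω] {P : Measure Ω} {X : D → Ω → ℝ}

/-- The supremum outside `S` is independent of the variables in `S`. -/
lemma indepFun_iSup_compl (hXm : ∀ i, Measurable (X i)) (hind : iIndepFun X P) (S : Finset D) :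
    IndepFun (fun ω => ⨆ i : {i // i ∉ S}, X i ω) (fun ω (s : {s // s ∈ S}) => X s ω) P := by
  rw [IndepFun_iff_Indep]
  have hdisj : Disjoint ((S : Set D)ᶜ) (S : Set D) := disjoint_compl_left
  refine indep_of_indep_of_le_left (indep_of_indep_of_le_right
    (indep_iSup_of_disjoint (fun i => (hXm i).comap_le) hind.iIndep hdisj) ?_) ?_
  · refine Measurable.comap_le ?_
    refine @measurable_pi_lambda _ _ _ (_) _ _ fun s => ?_
    exact (comap_measurable (X s)).mono (le_iSup₂_of_le (s : D) s.2 le_rfl) le_rfl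
  · refine Measurable.comap_le (Measurable.iSup fun i => ?_)
    exact (comap_measurable (X i)).mono (le_iSup₂_of_le (i : D) i.2 le_rfl) le_rfl

lemma nullMeasurableSet_forall_lt (hX : ∀ i, AEMeasurable (X i) P) (S : Finset D) :
    NullMeasurableSet {ω | ∀ s ∈ S, ∀ i ∉ S, X i ω < X s ω} P := by
  simp only [Set.ofPred_forall]
  exact .iInter fun s => .iInter fun _ => .iInter fun i => .iInter fun _ =>
    nullMeasurableSet_lt (hX i) (hX s)

variable [IsProbabilityMeasure P] {p : D → ℝ} {S : Finset D} {q : ℝ}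

lemma hasLaw_iSup_compl (hp : ∀ i, 0 < p i) (hq : 0 < q) (hpq : HasSum p (q + ∑ s ∈ S, p s))
    (hXm : ∀ i, Measurable (X i)) (hX : ∀ i, HasLaw (X i) (gumbelMeasure (Real.log (p i))) P)
    (hind : iIndepFun X P) :
    HasLaw (fun ω => ⨆ i : {i // i ∉ S}, X i ω) (gumbelMeasure (Real.log q)) P :=
  hasLaw_iSup_gumbel (p := fun i : {i // i ∉ S} => p i) (X := fun i : {i // i ∉ S} => X i)
    (fun i => hp i) hq (S.hasSum_compl_iff.2 hpq) (fun i => hXm i) (fun i => hX i)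
    (hind.precomp Subtype.val_injective)

lemma hasLaw_iSup_compl_prod (hp : ∀ i, 0 < p i) (hq : 0 < q)
    (hpq : HasSum p (q + ∑ s ∈ S, p s))
    (hXm : ∀ i, Measurable (X i)) (hX : ∀ i, HasLaw (X i) (gumbelMeasure (Real.log (p i))) P)
    (hind : iIndepFun X P) :
    HasLaw (fun ω => (⨆ i : {i // i ∉ S}, X i ω, fun s : {s // s ∈ S} => X s ω))
      ((gumbelMeasure (Real.log q)).prod
        (Measure.pi fun s : {s // s ∈ S} => gumbelMeasure (Real.log (p s)))) P where
  aemeasurable := ((Measurable.iSup fun i : {i // i ∉ S} => hXm i).prodMk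
    (measurable_pi_lambda _ fun s : {s // s ∈ S} => hXm s)).aemeasurable
  map_eq := by
    have hM : Measurable fun ω => ⨆ i : {i // i ∉ S}, X i ω := .iSup fun i => hXm i
    have hXS : Measurable fun ω (s : {s // s ∈ S}) => X s ω := measurable_pi_lambda _ fun s => hXm s
    have hpi := (iIndepFun_iff_map_fun_eq_pi_map (f := fun s : {s // s ∈ S} => X s)
      fun s => (hXm s).aemeasurable).1 (hind.precomp Subtype.val_injective)
    rw [(indepFun_iff_map_prod_eq_prod_map_map hM.aemeasurable hXS.aemeasurable).1
      (indepFun_iSup_compl hXm hind S), hpi, (hasLaw_iSup_compl hp hq hpq hXm hX hind).map_eq]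
    simp_rw [(hX _).map_eq]

/-- Ties between a member of `S` and the supremum outside `S` have probability zero, so the event
that `S` dominates its complement may be described by a strict comparison with that supremum. -/
lemma ae_eq_forall_iSup_lt (hp : ∀ i, 0 < p i) (hq : 0 < q) (hpq : HasSum p (q + ∑ s ∈ S, p s))
    (hXm : ∀ i, Measurable (X i)) (hX : ∀ i, HasLaw (X i) (gumbelMeasure (Real.log (p i))) P)
    (hind : iIndepFun X P) :
    {ω | ∀ s ∈ S, ∀ i ∉ S, X i ω < X s ω} =ᵐ[P]
      {ω | ∀ s : {s // s ∈ S}, ⨆ i : {i // i ∉ S}, X i ω < X s ω} := by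
  have hpq' : HasSum (fun i : {i // i ∉ S} => p i) q := S.hasSum_compl_iff.2 hpq
  have hne : Nonempty {i // i ∉ S} := by
    by_contra hempty
    rw [not_nonempty_iff] at hempty
    exact hq.ne' (hpq'.unique hasSum_empty)
  have hbdd := ae_bddAbove_gumbel (p := fun i : {i // i ∉ S} => p i)
    (X := fun i : {i // i ∉ S} => X i) (fun i => hp i) hq hpq' (fun i => hXm i) (fun i => hX i)
    (hind.precomp Subtype.val_injective)
  have hlaw := hasLaw_iSup_compl_prod hp hq hpq hXm hX hind
  have htie : ∀ᵐ ω ∂P, ∀ s : {s // s ∈ S}, ⨆ i : {i // i ∉ S}, X i ω ≠ X s ω := by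
    rw [ae_all_iff]
    intro s
    have hmeas : MeasurableSet {z : ℝ × ({s // s ∈ S} → ℝ) | z.1 = z.2 s} :=
      measurableSet_eq_fun measurable_fst ((measurable_pi_apply s).comp measurable_snd)
    have h0 : ((gumbelMeasure (Real.log q)).prod
        (Measure.pi fun s : {s // s ∈ S} => gumbelMeasure (Real.log (p s))))
        {z | z.1 = z.2 s} = 0 := by
      rw [Measure.measure_prod_null hmeas]
      refine .of_forall fun t => ?_
      have : Prod.mk t ⁻¹' {z : ℝ × ({s // s ∈ S} → ℝ) | z.1 = z.2 s} =
          Function.eval s ⁻¹' ({t} : Set ℝ) := by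
        ext y
        simp [eq_comm]
      exact (congrArg _ this).trans (Measure.pi_eval_preimage_null _ (gumbelMeasure_singleton _ t))
    rw [← hlaw.measure_eq hmeas] at h0
    simpa [ae_iff] using h0
  filter_upwards [hbdd, htie] with ω hb ht
  refine propext ⟨fun h s => lt_of_le_of_ne (ciSup_le fun i => (h s s.2 i i.2).le) (ht s), ?_⟩
  intro h s hs i hi
  exact (le_ciSup hb ⟨i, hi⟩).trans_lt (h ⟨s, hs⟩)

lemma setLIntegral_iSup_compl_of_measurable (hp : ∀ i, 0 < p i) (hq : 0 < q)
    (hpq : HasSum p (q + ∑ s ∈ S, p s))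
    (hXm : ∀ i, Measurable (X i)) (hX : ∀ i, HasLaw (X i) (gumbelMeasure (Real.log (p i))) P)
    (hind : iIndepFun X P) {h : ℝ → ENNReal} (hh : Measurable h) :
    ∫⁻ ω in {ω | ∀ s ∈ S, ∀ i ∉ S, X i ω < X s ω}, h (⨆ i : {i // i ∉ S}, X i ω) ∂P =
      ∫⁻ t, h t * ENNReal.ofReal (∏ s ∈ S, (1 - gumbelCDF (Real.log (p s)) t))
        ∂gumbelMeasure (Real.log q) := by
  have hlaw := hasLaw_iSup_compl_prod hp hq hpq hXm hX hind
  set A : Set (ℝ × ({s // s ∈ S} → ℝ)) := {z | ∀ s, z.1 < z.2 s} with hA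
  have hAm : MeasurableSet A := by
    rw [hA, Set.ofPred_forall]
    exact .iInter fun s =>
      measurableSet_lt measurable_fst ((measurable_pi_apply s).comp measurable_snd)
  have hVm : Measurable fun ω => (⨆ i : {i // i ∉ S}, X i ω, fun s : {s // s ∈ S} => X s ω) :=
    (Measurable.iSup fun i : {i // i ∉ S} => hXm i).prodMk (measurable_pi_lambda _ fun s => hXm s)
  have hhA : Measurable (A.indicator fun z => h z.1) := (hh.comp measurable_fst).indicator hAm
  have hslice (t : ℝ) : Prod.mk t ⁻¹' A = Set.univ.pi fun _ => Set.Ioi t := by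
    ext y
    simp [hA]
  calc ∫⁻ ω in {ω | ∀ s ∈ S, ∀ i ∉ S, X i ω < X s ω}, h (⨆ i : {i // i ∉ S}, X i ω) ∂P
    _ = ∫⁻ ω in (fun ω => (⨆ i : {i // i ∉ S}, X i ω, fun s : {s // s ∈ S} => X s ω)) ⁻¹' A,
          h (⨆ i : {i // i ∉ S}, X i ω) ∂P :=
        setLIntegral_congr (ae_eq_forall_iSup_lt hp hq hpq hXm hX hind)
    _ = ∫⁻ z, A.indicator (fun z => h z.1) z ∂((gumbelMeasure (Real.log q)).prod
          (Measure.pi fun s : {s // s ∈ S} => gumbelMeasure (Real.log (p s)))) := by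
        rw [← hlaw.map_eq, lintegral_map hhA hVm, ← lintegral_indicator (hVm hAm)]
        rfl
    _ = ∫⁻ t, ∫⁻ y, A.indicator (fun z => h z.1) (t, y)
          ∂(Measure.pi fun s : {s // s ∈ S} => gumbelMeasure (Real.log (p s)))
          ∂gumbelMeasure (Real.log q) := lintegral_prod _ hhA.aemeasurable
    _ = _ := by
        refine lintegral_congr fun t => ?_
        have hind_eq (y : {s // s ∈ S} → ℝ) : A.indicator (fun z => h z.1) (t, y) =
            (Prod.mk t ⁻¹' A).indicator (fun _ => h t) y := rfl
        simp_rw [hind_eq]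
        rw [lintegral_indicator_const (measurable_prodMk_left hAm), hslice, Measure.pi_pi]
        simp_rw [gumbelMeasure_Ioi]
        rw [← ENNReal.ofReal_prod_of_nonneg fun s _ => sub_nonneg.2 (gumbelCDF_lt_one _ _).le,
          prod_coe_sort S fun s => 1 - gumbelCDF (Real.log (p s)) t]

/-- Integrating over the event that `S` dominates its complement a function of the supremum
outside `S`: that supremum has a Gumbel law, and given its value `t` the members of `S` exceed it
independently with probabilities `1 - F_s(t)`. -/
lemma setLIntegral_iSup_compl (hp : ∀ i, 0 < p i) (hq : 0 < q)
    (hpq : HasSum p (q + ∑ s ∈ S, p s))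
    (hX : ∀ i, HasLaw (X i) (gumbelMeasure (Real.log (p i))) P)
    (hind : iIndepFun X P) {h : ℝ → ENNReal} (hh : Measurable h) :
    ∫⁻ ω in {ω | ∀ s ∈ S, ∀ i ∉ S, X i ω < X s ω}, h (⨆ i : {i // i ∉ S}, X i ω) ∂P =
      ∫⁻ t, h t * ENNReal.ofReal (∏ s ∈ S, (1 - gumbelCDF (Real.log (p s)) t))
        ∂gumbelMeasure (Real.log q) := by
  set Y : D → Ω → ℝ := fun i => (hX i).aemeasurable.mk (X i)
  have hXY (i : D) : X i =ᵐ[P] Y i := (hX i).aemeasurable.ae_eq_mk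
  have hall : ∀ᵐ ω ∂P, ∀ i, X i ω = Y i ω := ae_all_iff.2 hXY
  rw [← setLIntegral_iSup_compl_of_measurable hp hq hpq
    (fun i => (hX i).aemeasurable.measurable_mk) (fun i => (hX i).congr (hXY i).symm)
    (hind.congr hXY) hh]
  have hset : {ω | ∀ s ∈ S, ∀ i ∉ S, X i ω < X s ω} =ᵐ[P]
      {ω | ∀ s ∈ S, ∀ i ∉ S, Y i ω < Y s ω} := by
    filter_upwards [hall] with ω hω
    refine propext ?_
    change (∀ s ∈ S, ∀ i ∉ S, X i ω < X s ω) ↔ ∀ s ∈ S, ∀ i ∉ S, Y i ω < Y s ω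
    simp only [hω]
  rw [setLIntegral_congr hset]
  refine lintegral_congr_ae (ae_restrict_of_ae ?_)
  filter_upwards [hall] with ω hω
  simp only [hω, Y]

end Threshold

/-! ### Conditional expectations given the top `k` -/

section Conditional

variable {Ω : Type*} [Countable D] [MeasurableSpace Ω] {P : Measure Ω} [IsProbabilityMeasure P]
  {X : D → Ω → ℝ} {p : D → ℝ} {S : Finset D} {q : ℝ}

lemma measure_forall_lt (hp : ∀ i, 0 < p i) (hq : 0 < q)
    (hpq : HasSum p (q + ∑ s ∈ S, p s)) (hq1 : q + ∑ s ∈ S, p s = 1)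
    (hX : ∀ i, HasLaw (X i) (gumbelMeasure (Real.log (p i))) P) (hind : iIndepFun X P) :
    P {ω | ∀ s ∈ S, ∀ i ∉ S, X i ω < X s ω} = ENNReal.ofReal (unorderedProb p ∅ S) := by
  have h := setLIntegral_iSup_compl hp hq hpq hX hind (h := fun _ => 1) measurable_const
  simp only [lintegral_const, Measure.restrict_apply_univ, one_mul] at h
  rw [h, lintegral_prod_gumbelMeasure p hp S ∅ (disjoint_empty_left S) hq (by simpa using hq1)]

/-- Dividing by `1 - F_s` cancels the factor of `s` in the probability that `S` is on top, which
leaves the probability of sampling `S \ {s}` from `D \ {s}`. -/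
lemma setLIntegral_inv_one_sub_gumbelCDF [DecidableEq D] (hp : ∀ i, 0 < p i) (hq : 0 < q)
    (hpq : HasSum p (q + ∑ s ∈ S, p s)) (hq1 : q + ∑ s ∈ S, p s = 1)
    (hX : ∀ i, HasLaw (X i) (gumbelMeasure (Real.log (p i))) P) (hind : iIndepFun X P)
    {s : D} (hs : s ∈ S) :
    ∫⁻ ω in {ω | ∀ s ∈ S, ∀ i ∉ S, X i ω < X s ω},
      ENNReal.ofReal (1 / (1 - gumbelCDF (Real.log (p s)) (⨆ i : {i // i ∉ S}, X i ω))) ∂P =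
      ENNReal.ofReal (unorderedProb p {s} (S.erase s)) := by
  rw [setLIntegral_iSup_compl hp hq hpq hX hind
    (h := fun t => ENNReal.ofReal (1 / (1 - gumbelCDF (Real.log (p s)) t)))
    (((measurable_gumbelCDF _).const_sub 1).const_div 1).ennreal_ofReal,
    ← lintegral_prod_gumbelMeasure p hp (S.erase s) {s} (by simp) hq
      (by rw [sum_singleton, add_assoc, add_sum_erase S p hs, hq1])]
  refine lintegral_congr fun t => ?_
  have hpos : 0 < 1 - gumbelCDF (Real.log (p s)) t := sub_pos.2 (gumbelCDF_lt_one _ _)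
  rw [← ENNReal.ofReal_mul (one_div_pos.2 hpos).le, ← mul_prod_erase S _ hs, ← mul_assoc,
    one_div_mul_cancel hpos.ne', one_mul]

lemma integrable_inv_one_sub_gumbelCDF_and_integral_eq (hp : ∀ i, 0 < p i) (hq : 0 < q)
    (hpq : HasSum p (q + ∑ s ∈ S, p s)) (hq1 : q + ∑ s ∈ S, p s = 1)
    (hX : ∀ i, HasLaw (X i) (gumbelMeasure (Real.log (p i))) P) (hind : iIndepFun X P)
    {s : D} (hs : s ∈ S) :
    Integrable
      (fun ω => 1 / (1 - gumbelCDF (Real.log (p s)) (⨆ i : {i // i ∉ S}, X i ω)))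
      P[|{ω | ∀ s ∈ S, ∀ i ∉ S, X i ω < X s ω}] ∧
    ∫ ω, 1 / (1 - gumbelCDF (Real.log (p s)) (⨆ i : {i // i ∉ S}, X i ω))
      ∂P[|{ω | ∀ s ∈ S, ∀ i ∉ S, X i ω < X s ω}] = leaveOneOutRatio p S s := by
  classical
  set E := {ω | ∀ s ∈ S, ∀ i ∉ S, X i ω < X s ω}
  have hlint := setLIntegral_inv_one_sub_gumbelCDF hp hq hpq hq1 hX hind hs
  have hPE : P E = ENNReal.ofReal (unorderedProb p ∅ S) :=
    measure_forall_lt hp hq hpq hq1 hX hind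
  have hpos : 0 < unorderedProb p ∅ S :=
    unorderedProb_pos p hp S ∅ (disjoint_empty_left S) (by rw [sum_empty]; linarith)
  have hpos' : 0 < unorderedProb p {s} (S.erase s) :=
    unorderedProb_pos p hp _ _ (by simp) (by rw [sum_singleton, add_sum_erase S p hs]; linarith)
  have hnn : ∀ ω, 0 ≤ 1 / (1 - gumbelCDF (Real.log (p s)) (⨆ i : {i // i ∉ S}, X i ω)) :=
    fun ω => (one_div_pos.2 (sub_pos.2 (gumbelCDF_lt_one _ _))).le
  have hM : AEMeasurable (fun ω => ⨆ i : {i // i ∉ S}, X i ω) P :=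
    AEMeasurable.iSup fun i => (hX i).aemeasurable
  have hmeas : AEStronglyMeasurable
      (fun ω => 1 / (1 - gumbelCDF (Real.log (p s)) (⨆ i : {i // i ∉ S}, X i ω)))
      (P.restrict E) :=
    ((((measurable_gumbelCDF _).const_sub 1).const_div 1).comp_aemeasurable
      hM.restrict).aestronglyMeasurable
  rw [ProbabilityTheory.cond]
  constructor
  · refine Integrable.smul_measure ?_ (by simp [hPE, hpos])
    rw [← lintegral_ofReal_ne_top_iff_integrable hmeas (.of_forall hnn), hlint]
    exact ENNReal.ofReal_ne_top
  · rw [integral_smul_measure, integral_eq_lintegral_of_nonneg_ae (.of_forall hnn) hmeas, hlint,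
      hPE, ENNReal.toReal_ofReal hpos'.le, ENNReal.toReal_inv, ENNReal.toReal_ofReal hpos.le,
      smul_eq_mul, leaveOneOutRatio, div_eq_inv_mul]

end Conditional

end GumbelTopK

open GumbelTopK MeasureTheory ProbabilityTheory
theorem theorem6 {D Ω : Type*} [MeasurableSpace Ω] (P : Measure Ω) [IsProbabilityMeasure P]
    (p : D → ℝ) (hp : ∀ i, 0 < p i) (hp1 : HasSum p 1)
    (g : D → Ω → ℝ) (hg : ∀ i, HasLaw (g i) (gumbelMeasure 0) P) (hind : iIndepFun g P)
    (f : D → ℝ) (k : ℕ) (hk : (k : ℕ∞) < ENat.card D)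
    (Sk : Ω → Set D) (hSk : Sk = fun ω => topK k (perturbed p fun i => g i ω))
    (κ : Ω → ℝ) (hκ : κ = fun ω => nthLargest (k + 1) (perturbed p fun i => g i ω))
    (S : Finset D) (hS : S.card = k) :
    P {ω | Sk ω = S} ≠ 0 ∧
    (∀ s ∈ S,
      Integrable (fun ω => 1 / (1 - gumbelCDF (Real.log (p s)) (κ ω))) P[|{ω | Sk ω = S}] ∧
      ∫ ω, 1 / (1 - gumbelCDF (Real.log (p s)) (κ ω)) ∂P[|{ω | Sk ω = S}] =
        leaveOneOutRatio p S s) ∧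
    Integrable (fun ω => importanceWeightedEstimator p f S (κ ω)) P[|{ω | Sk ω = S}] ∧
    ∫ ω, importanceWeightedEstimator p f S (κ ω) ∂P[|{ω | Sk ω = S}] =
      unorderedSetEstimator p f S := by
  subst hS hSk hκ
  have hcount : Countable D := by
    have h := hp1.summable.countable_support
    rwa [Function.support_eq_univ fun i => (hp i).ne', Set.countable_univ_iff] at h
  obtain ⟨i₀, hi₀⟩ : ∃ i, i ∉ S := by
    by_contra! hall
    have huniv : (Set.univ : Set D) ⊆ S := fun i _ => hall i
    have := Set.encard_le_encard huniv
    rw [Set.encard_coe_eq_coe_finsetCard, Set.encard_univ] at this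
    exact absurd hk (not_lt.2 this)
  -- `q` is the mass outside `S`
  obtain ⟨q, hq1⟩ : ∃ q : ℝ, q + ∑ s ∈ S, p s = 1 := ⟨_, sub_add_cancel _ _⟩
  have hpq : HasSum p (q + ∑ s ∈ S, p s) := hq1 ▸ hp1
  have hq : 0 < q := (hp i₀).trans_le
    (le_hasSum (S.hasSum_compl_iff.2 hpq) ⟨i₀, hi₀⟩ fun i _ => (hp i).le)
  set X : D → Ω → ℝ := fun i ω => Real.log (p i) + g i ω
  have hX (i : D) : HasLaw (X i) (gumbelMeasure (Real.log (p i))) P :=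
    hasLaw_const_add_gumbel (hg i) _
  have hXind : iIndepFun X P :=
    hind.comp (fun i x => Real.log (p i) + x) fun i => measurable_const_add _
  have hset : {ω | topK S.card (perturbed p fun i => g i ω) = S} =
      {ω | ∀ s ∈ S, ∀ i ∉ S, X i ω < X s ω} :=
    Set.ext fun ω => topK_eq_iff _ S
  simp only [hset]
  set E := {ω | ∀ s ∈ S, ∀ i ∉ S, X i ω < X s ω}
  have hκ : ∀ᵐ ω ∂P[|E], nthLargest (S.card + 1) (perturbed p fun i => g i ω) =
      ⨆ i : {i // i ∉ S}, X i ω := by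
    refine Measure.ae_smul_measure ?_ _
    filter_upwards [ae_restrict_mem₀
      (nullMeasurableSet_forall_lt (fun i => (hX i).aemeasurable) S)] with ω hω
    exact nthLargest_eq_iSup _ S ⟨i₀, hi₀⟩ hω
  have hsingle : ∀ s ∈ S,
      Integrable (fun ω => 1 / (1 - gumbelCDF (Real.log (p s))
        (nthLargest (S.card + 1) (perturbed p fun i => g i ω)))) P[|E] ∧
      ∫ ω, 1 / (1 - gumbelCDF (Real.log (p s))
        (nthLargest (S.card + 1) (perturbed p fun i => g i ω))) ∂P[|E] =
          leaveOneOutRatio p S s := by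
    intro s hs
    obtain ⟨h1, h2⟩ := integrable_inv_one_sub_gumbelCDF_and_integral_eq hp hq hpq hq1 hX hXind hs
    have hcongr : (fun ω => 1 / (1 - gumbelCDF (Real.log (p s))
        (nthLargest (S.card + 1) (perturbed p fun i => g i ω)))) =ᵐ[P[|E]]
        fun ω => 1 / (1 - gumbelCDF (Real.log (p s)) (⨆ i : {i // i ∉ S}, X i ω)) := by
      filter_upwards [hκ] with ω hω
      rw [hω]
    exact ⟨h1.congr hcongr.symm, (integral_congr_ae hcongr).trans h2⟩
  have hest (t : ℝ) : importanceWeightedEstimator p f S t =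
      ∑ s ∈ S, p s * f s * (1 / (1 - gumbelCDF (Real.log (p s)) t)) :=
    Finset.sum_congr rfl fun s _ => by ring
  refine ⟨?_, hsingle, ?_, ?_⟩
  · rw [measure_forall_lt hp hq hpq hq1 hX hXind]
    exact (ENNReal.ofReal_pos.2 (unorderedProb_pos p hp S ∅ (Finset.disjoint_empty_left S)
      (by rw [Finset.sum_empty]; linarith))).ne'
  · simp_rw [hest]
    exact integrable_finsetSum _ fun s hs => (hsingle s hs).1.const_mul _
  · simp_rw [hest]
    rw [integral_finsetSum _ fun s hs => (hsingle s hs).1.const_mul _, unorderedSetEstimator]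
    refine Finset.sum_congr rfl fun s hs => ?_
    rw [integral_const_mul, (hsingle s hs).2]
    ring
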